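/- There are absolute constants $\rho, c, \varepsilon_0 > 0$ such that the following holds for every integer $n \ge 1$ and every $\varepsilon \in (0, \varepsilon_0]$. Let $\mathcal{C}$ be a class of probability distributions over $\{0,1\}^n$ such that 1. the uniform distribution on $\{0,1\}^n$ belongs to $\mathcal{C}$; 2. $\mathcal{C}$ is learnable to accuracy $\varepsilon$ with $m = m(n,\varepsilon)$ samples: there is a (possibly randomized, not necessarily proper) algorithm which, given $m$ independent samples from any unknown $P \in \mathcal{C}$, outputs with probability at least $2/3$ a distribution $Q$ over $\{0,1\}^n$ with $d_{\mathrm{TV}}(Q,P) \le \varepsilon$; 3. $mn \le 2^{\rho n}$. Then every (possibly randomized) algorithm which tests whether an arbitrary distribution over $\{0,1\}^n$ belongs to $\mathcal{C}$ or is $\varepsilon$-far from every member of $\mathcal{C}$ uses at least $c \cdot 2^{n/2}/\varepsilon^2$ samples. Here such an algorithm, given $s$ independent samples from an unknown $P$, has to accept with probability at least $2/3$ if $P \in \mathcal{C}$, and to reject with probability at least $2/3$ if $d_{\mathrm{TV}}(P,Q) \ge \varepsilon$ for all $Q \in \mathcal{C}$; and $d_{\mathrm{TV}}(P,Q) = \frac12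 \sum_x |P(x)-Q(x)|$ is the total variation distance. -/

import Mathlib

open scoped BigOperators

noncomputable section

/-- The Boolean cube `{0,1}^n`. -/
abbrev Cube (n : ℕ) : Type := Fin n → Bool

/-- Probability distributions on `{0,1}^n`, given by their mass functions (with the Borel
`σ`-algebra that the simplex inherits from `ℝ^{2^n}`). -/
abbrev Distr (n : ℕ) : Type := stdSimplex ℝ (Cube n)

/-- The uniform distribution on `{0,1}^n`. -/
def uniformDistr (n : ℕ) : Distr n :=
  ⟨fun _ => ((2 : ℝ) ^ n)⁻¹, fun _ => by positivity, by simp⟩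

/-- Total variation distance, as half of the `ℓ¹` distance of the mass functions. -/
def tvDist {n : ℕ} (P Q : Distr n) : ℝ := (1 / 2) * ∑ x, |P.1 x - Q.1 x|

/-- Probability of the sequence `x` when `k` independent samples are drawn from `P`. -/
def sampleProb {n k : ℕ} (P : Distr n) (x : Fin k → Cube n) : ℝ := ∏ i, P.1 (x i)

/-- `C` can be learned to accuracy `ε` from `m` samples: there is a (possibly randomized, possibly
improper) algorithm which, for every unknown `P ∈ C`, outputs with probability at least `2/3` a
distribution at total variation distance at most `ε` from `P`. The measure `H x` is the law of the
output on the input `x`. -/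
def LearnableWith {n : ℕ} (C : Set (Distr n)) (ε : ℝ) (m : ℕ) : Prop :=
  ∃ H : (Fin m → Cube n) → MeasureTheory.ProbabilityMeasure (Distr n),
    ∀ P ∈ C,
      2 / 3 ≤ ∑ x, sampleProb P x *
        (H x : MeasureTheory.Measure (Distr n)).real {Q | tvDist Q P ≤ ε}

/-- `P` is `ε`-far from `C`: at total variation distance at least `ε` from every member. -/
def IsFar {n : ℕ} (C : Set (Distr n)) (ε : ℝ) (P : Distr n) : Prop :=
  ∀ Q ∈ C, ε ≤ tvDist P Q

/-- `C` can be tested with `s` samples at distance `ε`: there is a (possibly randomized) algorithm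
which accepts every `P ∈ C` with probability at least `2/3`, and rejects every `P` that is
`ε`-far from `C` with probability at least `2/3`. The number `T x` is the probability that the
algorithm accepts on the input `x`. -/
def TestableWith {n : ℕ} (C : Set (Distr n)) (ε : ℝ) (s : ℕ) : Prop :=
  ∃ T : (Fin s → Cube n) → unitInterval,
    (∀ P ∈ C, 2 / 3 ≤ ∑ x, sampleProb P x * (T x : ℝ)) ∧
    (∀ P, IsFar C ε P → 2 / 3 ≤ ∑ x, sampleProb P x * (1 - (T x : ℝ)))

end

/-!
Split the cube into `N = 2 ^ (n - 1)` pairs of points that differ in the first bit, and tilt each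
pair by a relative amount `δ = 32 ε`, in a direction given by a bit: this makes `2 ^ N`
perturbations of the uniform distribution. By Ingster's method, `o(√N / δ ^ 2)` samples do not
distinguish a random perturbation from the uniform distribution. A tester with that few samples
accepts the uniform distribution, so it accepts most perturbations too often for them to be
`ε`-far, and a quarter of them is `ε`-close to the class. A Hamming ball of radius `N / 8` has at
most `2 ^ (3 N / 4)` points, so an output of the learner is correct for only that many of them,
and `m` samples take only `2 ^ (n m)` values: the learner needs `n m ≥ N / 4 - O(1)`. In the few
dimensions in which this bound is void, a learner with at most two samples is confused already by
the uniform distribution and one member close to a perturbation.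
-/

open Finset MeasureTheory
open scoped unitInterval

section Hamming

variable {ι β : Type*} [Fintype ι] [Fintype β] [DecidableEq β]

lemma sum_pow_hammingDist [DecidableEq ι] {R : Type*} [CommRing R] (t : R) (z : ι → β) :
    ∑ w : ι → β, t ^ hammingDist z w = (1 + (Fintype.card β - 1) * t) ^ Fintype.card ι := by
  have factor (i : ι) : ∑ b, (if z i ≠ b then t else 1) = 1 + (Fintype.card β - 1) * t := by
    rw [sum_ite, sum_const, sum_const, filter_ne, card_erase_of_mem (mem_univ _)]
    simp [Nat.cast_pred (Fintype.card_pos_iff.2 ⟨z i⟩), filter_eq, add_comm]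
  calc ∑ w : ι → β, t ^ hammingDist z w
      = ∑ w : ι → β, ∏ i, (if z i ≠ w i then t else 1) := by
        simp [hammingDist, prod_ite]
    _ = ∏ i, ∑ b, (if z i ≠ b then t else 1) :=
        (Fintype.prod_sum fun i b => if z i ≠ b then t else 1).symm
    _ = (1 + (Fintype.card β - 1) * t) ^ Fintype.card ι := by
        simp_rw [factor, prod_const, card_univ]

lemma card_mul_rpow_le_of_hammingDist_le {t : ℝ} (ht : 0 < t) (ht₁ : t ≤ 1) {r : ℝ} (z : ι → β)
    {A : Finset (ι → β)} (hA : ∀ w ∈ A, (hammingDist z w : ℝ) ≤ r) :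
    #A * t ^ r ≤ (1 + (Fintype.card β - 1) * t) ^ Fintype.card ι := by
  classical
  rw [← sum_pow_hammingDist t z, ← nsmul_eq_mul]
  calc #A • t ^ r ≤ ∑ w ∈ A, t ^ hammingDist z w := card_nsmul_le_sum _ _ _ fun w hw => by
        simpa using Real.rpow_le_rpow_of_exponent_ge ht ht₁ (hA w hw)
    _ ≤ ∑ w, t ^ hammingDist z w := sum_le_univ_sum_of_nonneg fun w => by positivity

lemma card_le_of_hammingDist_le_div_eight (z : ι → Bool) {A : Finset (ι → Bool)}
    (hA : ∀ w ∈ A, (hammingDist z w : ℝ) ≤ Fintype.card ι / 8) :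
    (#A : ℝ) ≤ 2 ^ (3 / 4 * Fintype.card ι : ℝ) := by
  set N := Fintype.card ι
  have ball : #A * (1 / 2 : ℝ) ^ (N / 8 : ℝ) ≤ (3 / 2) ^ N := by
    convert card_mul_rpow_le_of_hammingDist_le one_half_pos one_half_lt_one.le z hA using 2
    norm_num
  have base : (3 / 2 : ℝ) ≤ 2 ^ (5 / 8 : ℝ) := by
    rw [show (5 / 8 : ℝ) = 5 * 8⁻¹ by norm_num, Real.rpow_mul two_pos.le,
      Real.le_rpow_inv_iff_of_pos (by norm_num) (by positivity) (by norm_num)]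
    norm_num
  calc (#A : ℝ) = #A * (1 / 2 : ℝ) ^ (N / 8 : ℝ) * 2 ^ (N / 8 : ℝ) := by
        rw [mul_assoc, ← Real.mul_rpow (by norm_num) (by norm_num)]; norm_num
    _ ≤ ((2 : ℝ) ^ (5 / 8 : ℝ)) ^ N * 2 ^ (N / 8 : ℝ) := by
        gcongr
        exact ball.trans (by gcongr)
    _ = 2 ^ (3 / 4 * N : ℝ) := by
        rw [← Real.rpow_mul_natCast two_pos.le, ← Real.rpow_add two_pos]
        ring_nf

end Hamming

section FiniteDistributions

variable {α : Type*} [Fintype α]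

lemma sum_univ_cons_tail {M : Type*} [AddCommMonoid M] {k : ℕ} (F : α → (Fin k → α) → M) :
    ∑ x : Fin (k + 1) → α, F (x 0) (Fin.tail x) = ∑ a, ∑ y, F a y := by
  rw [← (Fin.consEquiv fun _ : Fin (k + 1) => α).sum_comp, Fintype.sum_prod_type]
  simp [Fin.consEquiv]

lemma prod_mem_stdSimplex {ι : Type*} [Fintype ι] [DecidableEq ι] {p : ι → α → ℝ}
    (hp : ∀ i, p i ∈ stdSimplex ℝ α) :
    (fun x : ι → α => ∏ i, p i (x i)) ∈ stdSimplex ℝ (ι → α) :=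
  ⟨fun x => prod_nonneg fun i _ => (hp i).1 (x i), by
    rw [← Fintype.prod_sum p]; exact prod_eq_one fun i _ => (hp i).2⟩

lemma sum_abs_prod_sub_prod_le {k : ℕ} {p q : Fin k → α → ℝ} (hp : ∀ i, p i ∈ stdSimplex ℝ α)
    (hq : ∀ i, q i ∈ stdSimplex ℝ α) :
    ∑ x : Fin k → α, |∏ i, p i (x i) - ∏ i, q i (x i)| ≤ ∑ i, ∑ a, |p i a - q i a| := by
  induction k with
  | zero => simp
  | succ k ih =>
    set P : (Fin k → α) → ℝ := fun y => ∏ i, p i.succ (y i)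
    set Q : (Fin k → α) → ℝ := fun y => ∏ i, q i.succ (y i)
    have hP : P ∈ stdSimplex ℝ (Fin k → α) := prod_mem_stdSimplex fun i => hp i.succ
    have split (a : α) (y : Fin k → α) : |p 0 a * P y - q 0 a * Q y|
        ≤ |p 0 a - q 0 a| * P y + q 0 a * |P y - Q y| := by
      calc |p 0 a * P y - q 0 a * Q y| = |(p 0 a - q 0 a) * P y + q 0 a * (P y - Q y)| := by
            ring_nf
        _ ≤ |(p 0 a - q 0 a) * P y| + |q 0 a * (P y - Q y)| := abs_add_le _ _
        _ = |p 0 a - q 0 a| * P y + q 0 a * |P y - Q y| := by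
            rw [abs_mul, abs_mul, abs_of_nonneg (hP.1 y), abs_of_nonneg ((hq 0).1 a)]
    calc ∑ x : Fin (k + 1) → α, |∏ i, p i (x i) - ∏ i, q i (x i)|
        = ∑ a, ∑ y, |p 0 a * P y - q 0 a * Q y| := by
          simp_rw [Fin.prod_univ_succ]
          exact sum_univ_cons_tail fun a y => |p 0 a * P y - q 0 a * Q y|
      _ ≤ ∑ a, ∑ y, (|p 0 a - q 0 a| * P y + q 0 a * |P y - Q y|) := by
          gcongr with a _ y _; exact split a y
      _ = ∑ a, |p 0 a - q 0 a| + ∑ y, |P y - Q y| := by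
          simp_rw [sum_add_distrib, ← mul_sum, hP.2, ← sum_mul, (hq 0).2, mul_one, one_mul]
      _ ≤ ∑ i, ∑ a, |p i a - q i a| := by
          rw [Fin.sum_univ_succ]; gcongr; exact ih (fun i => hp i.succ) fun i => hq i.succ

/-- The `χ²`-divergence of `p` from `q`, for mass functions on a finite type. Points of mass zero
under `q` contribute nothing, so it is meaningful only for `q > 0`. -/
noncomputable def chiSqDiv (p q : α → ℝ) : ℝ := ∑ x, (p x - q x) ^ 2 / q x

lemma chiSqDiv_eq_sum_sq_div_sub_one {p q : α → ℝ} (hp : ∑ x, p x = 1) (hq : ∑ x, q x = 1)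
    (hq₀ : ∀ x, q x ≠ 0) : chiSqDiv p q = ∑ x, p x ^ 2 / q x - 1 := by
  have expand (x : α) : (p x - q x) ^ 2 / q x = p x ^ 2 / q x - 2 * p x + q x := by
    have := hq₀ x
    field_simp
    ring
  simp_rw [chiSqDiv, expand, sum_add_distrib, sum_sub_distrib, ← mul_sum, hp, hq]
  ring

lemma sq_sum_mul_sub_sum_mul_le_chiSqDiv {p q T : α → ℝ} (hq : ∑ x, q x = 1) (hq₀ : ∀ x, 0 < q x)
    (hT : ∀ x, |T x| ≤ 1) : (∑ x, p x * T x - ∑ x, q x * T x) ^ 2 ≤ chiSqDiv p q := by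
  calc (∑ x, p x * T x - ∑ x, q x * T x) ^ 2
      = (∑ x, (p x - q x) * T x) ^ 2 / ∑ x, q x := by
        simp_rw [sub_mul, sum_sub_distrib, hq, div_one]
    _ ≤ ∑ x, ((p x - q x) * T x) ^ 2 / q x := sq_sum_div_le_sum_sq_div _ _ fun x _ => hq₀ x
    _ ≤ chiSqDiv p q := sum_le_sum fun x _ => by
        have := (sq_le_one_iff_abs_le_one _).2 (hT x)
        have := (hq₀ x).le
        rw [mul_pow]
        gcongr
        exact mul_le_of_le_one_right (sq_nonneg _) ‹_›

lemma sum_sq_expect_prod_div_prod {ι : Type*} [Fintype ι] (p : ι → α → ℝ) (q : α → ℝ) (s : ℕ) :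
    ∑ x : Fin s → α, (𝔼 z, ∏ i, p z (x i)) ^ 2 / ∏ i, q (x i)
      = 𝔼 z, 𝔼 w, (∑ a, p z a * p w a / q a) ^ s := by
  simp_rw [Fintype.sum_pow, sq, expect_mul_expect, expect_div, ← prod_mul_distrib,
    ← prod_div_distrib]
  rw [← expect_sum_comm]
  simp_rw [expect_sum_comm]

end FiniteDistributions

section Sampling

variable {n : ℕ}

lemma sampleProb_mem_stdSimplex {k : ℕ} (P : Distr n) :
    sampleProb P ∈ stdSimplex ℝ (Fin k → Cube n) :=
  prod_mem_stdSimplex fun _ => P.2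

lemma sampleProb_uniformDistr_pos {k : ℕ} (x : Fin k → Cube n) :
    0 < sampleProb (uniformDistr n) x :=
  prod_pos fun _ _ => by simp [uniformDistr]

lemma uniformDistr_apply (x : Cube n) : (uniformDistr n).1 x = ((2 : ℝ) ^ n)⁻¹ := rfl

lemma tvDist_comm (P Q : Distr n) : tvDist P Q = tvDist Q P := by
  simp only [tvDist, abs_sub_comm]

lemma tvDist_triangle (P Q R : Distr n) : tvDist P R ≤ tvDist P Q + tvDist Q R := by
  simp only [tvDist]
  rw [← mul_add, ← sum_add_distrib]
  gcongr
  exact abs_sub_le _ _ _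

lemma measurableSet_tvDist_le (P : Distr n) (r : ℝ) :
    MeasurableSet {Q : Distr n | tvDist Q P ≤ r} := by
  have measurable_mass (x : Cube n) : Measurable fun Q : Distr n => Q.1 x :=
    (measurable_pi_apply x).comp measurable_subtype_coe
  exact measurableSet_le ((Finset.measurable_sum _ fun x _ =>
    ((measurable_mass x).sub_const _).abs).const_mul _) measurable_const

lemma not_isFar_iff {C : Set (Distr n)} {ε : ℝ} {P : Distr n} :
    ¬IsFar C ε P ↔ ∃ Q ∈ C, tvDist P Q < ε := by
  simp [IsFar]

lemma sum_max_sampleProb_le (P Q : Distr n) (k : ℕ) :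
    ∑ x : Fin k → Cube n, max (sampleProb P x) (sampleProb Q x) ≤ 1 + k * tvDist P Q := by
  have hybrid : ∑ x : Fin k → Cube n, |sampleProb Q x - sampleProb P x| ≤ k * (2 * tvDist P Q) := by
    refine (sum_abs_prod_sub_prod_le (fun _ => Q.2) fun _ => P.2).trans_eq ?_
    rw [tvDist_comm]
    simp [tvDist]
  simp_rw [sup_eq_half_smul_add_add_abs_sub' ℝ, smul_eq_mul, ← mul_sum, sum_add_distrib,
    (sampleProb_mem_stdSimplex _).2]
  linarith

end Sampling

section Learning

lemma sum_measureReal_le_of_sum_indicator_le {Ω ι : Type*} [MeasurableSpace Ω] (μ : Measure Ω)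
    [IsProbabilityMeasure μ] {G : Finset ι} {B : ι → Set Ω} (hB : ∀ i ∈ G, MeasurableSet (B i))
    {V : ℝ} (hV : ∀ ω, ∑ i ∈ G, (B i).indicator 1 ω ≤ V) : ∑ i ∈ G, μ.real (B i) ≤ V := by
  have integrable (i : ι) (hi : i ∈ G) : Integrable ((B i).indicator (1 : Ω → ℝ)) μ :=
    (integrable_const 1).indicator (hB i hi)
  calc ∑ i ∈ G, μ.real (B i) = ∑ i ∈ G, ∫ ω, (B i).indicator (1 : Ω → ℝ) ω ∂μ :=
        sum_congr rfl fun i hi => (integral_indicator_one (hB i hi)).symm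
    _ = ∫ ω, ∑ i ∈ G, (B i).indicator (1 : Ω → ℝ) ω ∂μ := (integral_finsetSum _ integrable).symm
    _ ≤ ∫ _, V ∂μ := integral_mono (integrable_finsetSum _ integrable) (integrable_const _) hV
    _ = V := by simp

namespace LearnableWith

variable {n m : ℕ} {C : Set (Distr n)} {ε : ℝ}

lemma card_le {ι : Type*} (h : LearnableWith C ε m) {G : Finset ι} {Q : ι → Distr n}
    (hQ : ∀ i ∈ G, Q i ∈ C) {M : (Fin m → Cube n) → ℝ} (hM₀ : ∀ x, 0 ≤ M x)
    (hM : ∀ i ∈ G, ∀ x, sampleProb (Q i) x ≤ M x) {V : ℝ}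
    (hV : ∀ R, (#{i ∈ G | tvDist R (Q i) ≤ ε} : ℝ) ≤ V) :
    #G * (2 / 3) ≤ (∑ x, M x) * V := by
  obtain ⟨H, hH⟩ := h
  let success (x : Fin m → Cube n) (i : ι) : ℝ :=
    (H x : Measure (Distr n)).real {R | tvDist R (Q i) ≤ ε}
  have sum_success_le (x : Fin m → Cube n) : ∑ i ∈ G, success x i ≤ V := by
    refine sum_measureReal_le_of_sum_indicator_le _ (fun i _ => measurableSet_tvDist_le _ _)
      fun R => ?_
    simpa [Set.indicator_apply] using hV R
  calc #G * (2 / 3) ≤ ∑ i ∈ G, ∑ x, sampleProb (Q i) x * success x i := by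
        rw [← nsmul_eq_mul]
        exact card_nsmul_le_sum _ _ _ fun i hi => hH _ (hQ i hi)
    _ ≤ ∑ i ∈ G, ∑ x, M x * success x i := by
        gcongr with i hi x _
        exact hM i hi x
    _ = ∑ x, M x * ∑ i ∈ G, success x i := by
        rw [sum_comm]
        simp_rw [mul_sum]
    _ ≤ (∑ x, M x) * V := by
        rw [sum_mul]
        gcongr with x _
        · exact hM₀ x
        · exact sum_success_le x

lemma card_le_two_pow_mul {ι : Type*} (h : LearnableWith C ε m) {G : Finset ι} {Q : ι → Distr n}
    (hQ : ∀ i ∈ G, Q i ∈ C) {V : ℝ} (hV : ∀ R, (#{i ∈ G | tvDist R (Q i) ≤ ε} : ℝ) ≤ V) :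
    #G * (2 / 3) ≤ 2 ^ (n * m) * V := by
  have sampleProb_le_one (i : ι) (_ : i ∈ G) (x : Fin m → Cube n) : sampleProb (Q i) x ≤ 1 :=
    (mem_Icc_of_mem_stdSimplex (sampleProb_mem_stdSimplex (Q i)) x).2
  simpa [pow_mul] using h.card_le hQ (fun _ => zero_le_one) sampleProb_le_one hV

lemma one_third_le_mul_tvDist (h : LearnableWith C ε m) {P Q : Distr n} (hP : P ∈ C) (hQ : Q ∈ C)
    (hPQ : 2 * ε < tvDist P Q) : 1 / 3 ≤ m * tvDist P Q := by
  have unique (R : Distr n) : #{b : Bool | tvDist R (cond b P Q) ≤ ε} ≤ 1 := by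
    have := tvDist_triangle P R Q
    rw [tvDist_comm P R] at this
    rw [card_le_one]
    rintro (_ | _) h₁ (_ | _) h₂ <;> simp at h₁ h₂ ⊢ <;> linarith
  have := h.card_le (G := univ) (Q := fun b => cond b P Q)
    (M := fun x => max (sampleProb P x) (sampleProb Q x)) (V := 1)
    (by simp [hP, hQ]) (fun x => le_max_of_le_left ((sampleProb_mem_stdSimplex P).1 x))
    (by simp) (fun R => mod_cast unique R)
  rw [card_univ, Fintype.card_bool, mul_one] at this
  push_cast at this
  linarith [sum_max_sampleProb_le P Q m]

end LearnableWith

end Learning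

section Perturbation

variable {k : ℕ}

/-- The mass of a point with first bit `c` in a pair of points of `{0,1} ^ (k + 1)` that differ only
in the first bit, when the pair is tilted towards its point with first bit `b`: heavier than uniform
by the factor `1 + δ` if `c = b`, and lighter by the factor `1 - δ` otherwise. -/
noncomputable def tiltedMass (k : ℕ) (δ : I) (b c : Bool) : ℝ :=
  (if b = c then 1 + (δ : ℝ) else 1 - δ) / 2 ^ (k + 1)

lemma tiltedMass_nonneg (δ : I) (b c : Bool) : 0 ≤ tiltedMass k δ b c := by
  have := sub_nonneg.2 δ.2.2
  have := δ.2.1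
  unfold tiltedMass
  split_ifs <;> positivity

lemma sum_tiltedMass (δ : I) (b : Bool) : ∑ c, tiltedMass k δ b c = ((2 : ℝ) ^ k)⁻¹ := by
  cases b <;> simp [tiltedMass] <;> field

lemma sum_abs_tiltedMass_sub (δ : I) (b b' : Bool) :
    ∑ c, |tiltedMass k δ b c - tiltedMass k δ b' c|
      = if b ≠ b' then 2 * (δ / 2 ^ k : ℝ) else 0 := by
  have gap : |(δ : ℝ) + δ| = 2 * δ := by
    rw [← two_mul, abs_of_nonneg (mul_nonneg two_pos.le δ.2.1)]
  simp_rw [tiltedMass, ← sub_div, abs_div, ← sum_div]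
  cases b <;> cases b' <;> simp [gap, abs_sub_comm (1 - (δ : ℝ))] <;> field

lemma sum_tiltedMass_mul_div (δ : I) (b b' : Bool) :
    ∑ c, tiltedMass k δ b c * tiltedMass k δ b' c / ((2 : ℝ) ^ (k + 1))⁻¹
      = (1 + δ ^ 2) / 2 ^ k - if b ≠ b' then 2 * (δ : ℝ) ^ 2 / 2 ^ k else 0 := by
  cases b <;> cases b' <;> simp [tiltedMass] <;> field

/-- The hard instances of Paninski's lower bound for uniformity testing: for every `y`, the pair
`(false, y)`, `(true, y)` is tilted by the relative amount `δ` towards `(z y, y)`. -/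
noncomputable def perturbedUniform (δ : I) (z : Cube k → Bool) : Distr (k + 1) :=
  ⟨fun x => tiltedMass k δ (z (Fin.tail x)) (x 0), fun _ => tiltedMass_nonneg δ _ _, by
    dsimp only
    rw [sum_univ_cons_tail fun c y => tiltedMass k δ (z y) c, sum_comm]
    simp_rw [sum_tiltedMass]
    simp⟩

variable (δ : I) (z w : Cube k → Bool)

lemma perturbedUniform_apply (x : Cube (k + 1)) :
    (perturbedUniform δ z).1 x = tiltedMass k δ (z (Fin.tail x)) (x 0) := rfl

lemma tvDist_perturbedUniform_uniformDistr :
    tvDist (perturbedUniform δ z) (uniformDistr (k + 1)) = δ / 2 := by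
  have mass_diff (x : Cube (k + 1)) :
      |(perturbedUniform δ z).1 x - (uniformDistr (k + 1)).1 x| = δ / 2 ^ (k + 1) := by
    rw [perturbedUniform_apply, uniformDistr_apply, tiltedMass, inv_eq_one_div, ← sub_div, abs_div]
    split_ifs <;> simp [abs_of_nonneg δ.2.1]
  simp only [tvDist, mass_diff, sum_const, card_univ, Fintype.card_pi, Fintype.card_bool,
    prod_const, Fintype.card_fin, nsmul_eq_mul, Nat.cast_pow, Nat.cast_ofNat]
  field

lemma tvDist_perturbedUniform :
    tvDist (perturbedUniform δ z) (perturbedUniform δ w) = δ * hammingDist z w / 2 ^ k := by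
  simp only [tvDist, perturbedUniform_apply]
  rw [sum_univ_cons_tail fun c y => |tiltedMass k δ (z y) c - tiltedMass k δ (w y) c|, sum_comm]
  simp_rw [sum_abs_tiltedMass_sub, ← sum_filter, sum_const, hammingDist, nsmul_eq_mul]
  ring

lemma sum_perturbedUniform_mul_div_uniformDistr :
    ∑ x, (perturbedUniform δ z).1 x * (perturbedUniform δ w).1 x / (uniformDistr (k + 1)).1 x
      = 1 + δ ^ 2 / 2 ^ k * (2 ^ k - 2 * hammingDist z w) := by
  simp only [perturbedUniform_apply, uniformDistr_apply]
  rw [sum_univ_cons_tail fun c y =>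
    tiltedMass k δ (z y) c * tiltedMass k δ (w y) c / ((2 : ℝ) ^ (k + 1))⁻¹, sum_comm]
  simp_rw [sum_tiltedMass_mul_div, sum_sub_distrib, ← sum_filter, sum_const, ← hammingDist.eq_1,
    card_univ, Fintype.card_pi, Fintype.card_bool, prod_const, card_univ, Fintype.card_fin,
    nsmul_eq_mul, Nat.cast_pow, Nat.cast_ofNat]
  field

lemma sum_perturbedUniform_mul_div_uniformDistr_pow_le (s : ℕ) :
    (∑ x, (perturbedUniform δ z).1 x * (perturbedUniform δ w).1 x / (uniformDistr (k + 1)).1 x) ^ s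
      ≤ Real.exp (s * δ ^ 2 / 2 ^ k * (2 ^ k - 2 * hammingDist z w)) := by
  calc _ ≤ Real.exp (δ ^ 2 / 2 ^ k * (2 ^ k - 2 * hammingDist z w)) ^ s := by
        have mass_nonneg (P : Distr (k + 1)) (x : Cube (k + 1)) : 0 ≤ P.1 x := P.2.1 x
        gcongr
        · exact sum_nonneg fun x _ =>
            div_nonneg (mul_nonneg (mass_nonneg _ x) (mass_nonneg _ x)) (mass_nonneg _ x)
        · rw [sum_perturbedUniform_mul_div_uniformDistr, add_comm]
          exact Real.add_one_le_exp _
    _ = Real.exp (s * δ ^ 2 / 2 ^ k * (2 ^ k - 2 * hammingDist z w)) := by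
        rw [← Real.exp_nat_mul]
        ring_nf

lemma expect_exp_sub_two_mul_hammingDist {ι : Type*} [Fintype ι] [DecidableEq ι] (a : ℝ)
    (z : ι → Bool) :
    𝔼 w : ι → Bool, Real.exp (a * (Fintype.card ι - 2 * hammingDist z w))
      = Real.cosh a ^ Fintype.card ι := by
  have factor (w : ι → Bool) : Real.exp (a * (Fintype.card ι - 2 * hammingDist z w))
      = Real.exp a ^ Fintype.card ι * Real.exp (-2 * a) ^ hammingDist z w := by
    rw [← Real.exp_nat_mul, ← Real.exp_nat_mul, ← Real.exp_add]
    ring_nf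
  have half_sum : Real.exp a * ((1 + Real.exp (-2 * a)) / 2) = Real.cosh a := by
    rw [Real.cosh_eq, mul_div_assoc', mul_add, mul_one, ← Real.exp_add]
    ring_nf
  simp_rw [factor, ← mul_expect, Fintype.expect_eq_sum_div_card, sum_pow_hammingDist, ← half_sum,
    mul_pow, div_pow]
  norm_num

lemma chiSqDiv_expect_perturbedUniform_le (s : ℕ) :
    chiSqDiv (fun x : Fin s → Cube (k + 1) => 𝔼 z, sampleProb (perturbedUniform δ z) x)
        (sampleProb (uniformDistr (k + 1)))
      ≤ Real.exp (s ^ 2 * δ ^ 4 / (2 * 2 ^ k)) - 1 := by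
  set a : ℝ := s * δ ^ 2 / 2 ^ k with ha
  have sum_mixture :
      ∑ x : Fin s → Cube (k + 1), 𝔼 z, sampleProb (perturbedUniform δ z) x = 1 := by
    rw [← expect_sum_comm]
    simp [(sampleProb_mem_stdSimplex _).2]
  have expect_exp (z : Cube k → Bool) :
      𝔼 w : Cube k → Bool, Real.exp (a * (2 ^ k - 2 * hammingDist z w)) = Real.cosh a ^ 2 ^ k := by
    simpa using expect_exp_sub_two_mul_hammingDist a z
  rw [chiSqDiv_eq_sum_sq_div_sub_one sum_mixture (sampleProb_mem_stdSimplex _).2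
    fun x => (sampleProb_uniformDistr_pos x).ne']
  gcongr
  calc ∑ x : Fin s → Cube (k + 1), (𝔼 z, sampleProb (perturbedUniform δ z) x) ^ 2
          / sampleProb (uniformDistr (k + 1)) x
      = 𝔼 z, 𝔼 w, (∑ x, (perturbedUniform δ z).1 x * (perturbedUniform δ w).1 x
          / (uniformDistr (k + 1)).1 x) ^ s :=
        sum_sq_expect_prod_div_prod (fun z => (perturbedUniform δ z).1) _ s
    _ ≤ 𝔼 z : Cube k → Bool, 𝔼 w : Cube k → Bool,
          Real.exp (a * (2 ^ k - 2 * hammingDist z w)) :=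
        expect_le_expect fun z _ => expect_le_expect fun w _ =>
          sum_perturbedUniform_mul_div_uniformDistr_pow_le δ z w s
    _ = Real.cosh a ^ 2 ^ k := by
        simp_rw [expect_exp, Fintype.expect_const]
    _ ≤ Real.exp (a ^ 2 / 2) ^ 2 ^ k := by
        gcongr
        exact Real.cosh_le_exp_half_sq a
    _ = Real.exp (s ^ 2 * δ ^ 4 / (2 * 2 ^ k)) := by
        rw [← Real.exp_nat_mul, ha]
        congr 1
        push_cast
        field

lemma abs_expect_perturbedUniform_sub_uniformDistr_le {s : ℕ}
    (hs : (s : ℝ) ^ 2 * δ ^ 4 ≤ 2 ^ k / 36) (T : (Fin s → Cube (k + 1)) → I) :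
    |𝔼 z, ∑ x, sampleProb (perturbedUniform δ z) x * T x
      - ∑ x, sampleProb (uniformDistr (k + 1)) x * T x| ≤ 1 / 6 := by
  have abs_T_le (x : Fin s → Cube (k + 1)) : |(T x : ℝ)| ≤ 1 := by
    rw [abs_of_nonneg (T x).2.1]
    exact (T x).2.2
  have exponent_le : (s : ℝ) ^ 2 * δ ^ 4 / (2 * 2 ^ k) ≤ 1 / 72 := by
    rw [div_le_iff₀ (by positivity)]
    linarith
  have exp_le : Real.exp (1 / 72) - 1 ≤ (1 / 6) ^ 2 :=
    calc Real.exp (1 / 72) - 1 ≤ |Real.exp (1 / 72) - 1| := le_abs_self _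
      _ ≤ 2 * |1 / 72| := Real.abs_exp_sub_one_le (by norm_num [abs_of_pos])
      _ = (1 / 6) ^ 2 := by norm_num [abs_of_pos]
  rw [expect_sum_comm]
  simp_rw [← expect_mul]
  refine abs_le_of_sq_le_sq ?_ (by norm_num)
  calc _ ≤ chiSqDiv (fun x : Fin s → Cube (k + 1) => 𝔼 z, sampleProb (perturbedUniform δ z) x)
          (sampleProb (uniformDistr (k + 1))) :=
        sq_sum_mul_sub_sum_mul_le_chiSqDiv (sampleProb_mem_stdSimplex _).2
          sampleProb_uniformDistr_pos abs_T_le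
    _ ≤ Real.exp (s ^ 2 * δ ^ 4 / (2 * 2 ^ k)) - 1 := chiSqDiv_expect_perturbedUniform_le δ s
    _ ≤ Real.exp (1 / 72) - 1 := by gcongr
    _ ≤ (1 / 6) ^ 2 := exp_le

open Classical in
/-- The directions `z` for which the perturbation `perturbedUniform δ z` is at distance less than
`ε` from some member of `C`. -/
noncomputable def nearDirections (C : Set (Distr (k + 1))) (ε : ℝ) (δ : I) :
    Finset (Cube k → Bool) :=
  {z | ¬IsFar C ε (perturbedUniform δ z)}

variable {C : Set (Distr (k + 1))} {ε : ℝ} {δ z}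

lemma mem_nearDirections :
    z ∈ nearDirections C ε δ ↔ ∃ Q ∈ C, tvDist (perturbedUniform δ z) Q < ε := by
  simp [nearDirections, not_isFar_iff]

lemma TestableWith.two_pow_le_four_mul_card_nearDirections {s : ℕ} (h : TestableWith C ε s)
    (hU : uniformDistr (k + 1) ∈ C) (hs : (s : ℝ) ^ 2 * δ ^ 4 ≤ 2 ^ k / 36) :
    (2 : ℝ) ^ 2 ^ k ≤ 4 * #(nearDirections C ε δ) := by
  obtain ⟨T, accepts, rejects⟩ := h
  let accept (z : Cube k → Bool) : ℝ := ∑ x, sampleProb (perturbedUniform δ z) x * (T x : ℝ)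
  have half_le : 1 / 2 ≤ 𝔼 z, accept z := by
    have := abs_le.1 (abs_expect_perturbedUniform_sub_uniformDistr_le δ hs T)
    linarith [accepts _ hU]
  have accept_le (z : Cube k → Bool) :
      accept z ≤ 1 / 3 + if z ∈ nearDirections C ε δ then 2 / 3 else 0 := by
    obtain ⟨nonneg, sum_one⟩ := sampleProb_mem_stdSimplex (k := s) (perturbedUniform δ z)
    split_ifs with hz
    · calc accept z ≤ ∑ x, sampleProb (perturbedUniform δ z) x :=
            sum_le_sum fun x _ => mul_le_of_le_one_right (nonneg x) (T x).2.2
        _ = 1 / 3 + 2 / 3 := by rw [sum_one]; norm_num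
    · have := rejects (perturbedUniform δ z) (by simpa [nearDirections] using hz)
      simp_rw [mul_one_sub, sum_sub_distrib, sum_one] at this
      linarith
  have le_density : 1 / 2 ≤ 1 / 3 + #(nearDirections C ε δ) * (2 / 3) / (2 : ℝ) ^ 2 ^ k := by
    refine (half_le.trans (expect_le_expect fun z _ => accept_le z)).trans_eq ?_
    rw [expect_add_distrib, Fintype.expect_const, Fintype.expect_eq_sum_div_card, ← sum_filter]
    simp
  have : (0 : ℝ) < 2 ^ 2 ^ k := by positivity
  rw [← sub_le_iff_le_add', le_div_iff₀ this] at le_density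
  linarith

lemma card_tvDist_le_of_tvDist_perturbedUniform_lt {G : Finset (Cube k → Bool)}
    {Q : (Cube k → Bool) → Distr (k + 1)} (hε : 0 < ε) (hδ : 32 * ε ≤ δ)
    (hQ : ∀ z ∈ G, tvDist (perturbedUniform δ z) (Q z) < ε) (R : Distr (k + 1)) :
    (#{z ∈ G | tvDist R (Q z) ≤ ε} : ℝ) ≤ 2 ^ (3 / 4 * 2 ^ k : ℝ) := by
  set A : Finset (Cube k → Bool) := {z ∈ G | tvDist R (Q z) ≤ ε}
  have tvDist_lt {z : Cube k → Bool} (hz : z ∈ A) : tvDist (perturbedUniform δ z) R < 2 * ε := by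
    obtain ⟨hzG, hzR⟩ := mem_filter.1 hz
    rw [tvDist_comm] at hzR
    linarith [tvDist_triangle (perturbedUniform δ z) (Q z) R, hQ z hzG]
  obtain hA | ⟨z, hz⟩ := A.eq_empty_or_nonempty
  · rw [hA, card_empty, Nat.cast_zero]
    positivity
  have hammingDist_le (w : Cube k → Bool) (hw : w ∈ A) :
      (hammingDist z w : ℝ) ≤ Fintype.card (Cube k) / 8 := by
    have close := tvDist_triangle (perturbedUniform δ z) R (perturbedUniform δ w)
    rw [tvDist_comm R, tvDist_perturbedUniform] at close
    have : 32 * ε * hammingDist z w / 2 ^ k ≤ δ * hammingDist z w / 2 ^ k := by gcongr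
    have : 32 * ε * hammingDist z w / 2 ^ k ≤ 4 * ε := by linarith [tvDist_lt hz, tvDist_lt hw]
    rw [div_le_iff₀ (by positivity)] at this
    have : 32 * ε * hammingDist z w ≤ 32 * ε * (2 ^ k / 8) := by linarith
    simpa using le_of_mul_le_mul_left this (by positivity)
  simpa using card_le_of_hammingDist_le_div_eight z hammingDist_le

namespace LearnableWith

variable {m : ℕ}

lemma two_pow_lt (h : LearnableWith C ε m) (hε : 0 < ε) (hδ : 32 * ε ≤ δ)
    (hG : (2 : ℝ) ^ 2 ^ k ≤ 4 * #(nearDirections C ε δ)) : 2 ^ k < 4 * ((k + 1) * m) + 12 := by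
  choose! Q hQC hQ using fun z => (mem_nearDirections (C := C) (ε := ε) (δ := δ) (z := z)).1
  have packing := h.card_le_two_pow_mul hQC <|
    card_tvDist_le_of_tvDist_perturbedUniform_lt hε hδ hQ
  have : (2 : ℝ) ^ (2 ^ k : ℝ) < 2 ^ (((k + 1) * m + 3 : ℕ) + 3 / 4 * 2 ^ k : ℝ) := by
    have pos : (0 : ℝ) < 2 ^ ((k + 1) * m) * 2 ^ (3 / 4 * 2 ^ k : ℝ) := by positivity
    rw [Real.rpow_add two_pos, Real.rpow_natCast, pow_add]
    rw [← Real.rpow_natCast] at hG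
    push_cast at hG
    linarith
  rw [Real.rpow_lt_rpow_left_iff one_lt_two] at this
  push_cast at this
  have : (2 : ℝ) ^ k < 4 * ((k + 1) * m) + 12 := by linarith
  exact_mod_cast this

lemma one_third_le_of_mem_nearDirections (h : LearnableWith C ε m)
    (hU : uniformDistr (k + 1) ∈ C) (hδ : 6 * ε ≤ δ) (hz : z ∈ nearDirections C ε δ) :
    (1 / 3 : ℝ) ≤ m * (δ / 2 + ε) := by
  obtain ⟨Q, hQC, hQ⟩ := mem_nearDirections.1 hz
  have lower := tvDist_triangle (perturbedUniform δ z) Q (uniformDistr (k + 1))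
  have upper := tvDist_triangle (uniformDistr (k + 1)) (perturbedUniform δ z) Q
  rw [tvDist_comm Q] at lower
  rw [tvDist_comm _ (perturbedUniform δ z)] at upper
  rw [tvDist_perturbedUniform_uniformDistr] at lower upper
  calc (1 / 3 : ℝ) ≤ m * tvDist (uniformDistr (k + 1)) Q :=
        h.one_third_le_mul_tvDist hU hQC (by linarith)
    _ ≤ m * (δ / 2 + ε) := by gcongr; linarith

lemma two_rpow_lt_mul (h : LearnableWith C ε m) (hU : uniformDistr (k + 1) ∈ C) (hε : 0 < ε)
    (hε₀ : ε ≤ 1 / 128) (hδ : δ = 32 * ε) (hG : (2 : ℝ) ^ 2 ^ k ≤ 4 * #(nearDirections C ε δ)) :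
    (2 : ℝ) ^ (1 / 6 * (k + 1) : ℝ) < m * (k + 1) := by
  by_contra! hm
  obtain hk | hk := lt_or_ge k 5
  · have hm₂ : (m : ℝ) ≤ 2 := by
      have : (k : ℝ) ≤ 4 := mod_cast Nat.le_of_lt_succ hk
      calc (m : ℝ) ≤ m * (k + 1) := le_mul_of_one_le_right m.cast_nonneg (by simp)
        _ ≤ 2 ^ (1 / 6 * (k + 1) : ℝ) := hm
        _ ≤ 2 ^ (1 : ℝ) := Real.rpow_le_rpow_of_exponent_le one_le_two (by linarith)
        _ = 2 := Real.rpow_one 2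
    obtain ⟨z, hz⟩ : (nearDirections C ε δ).Nonempty := by
      have := (pow_pos two_pos _).trans_le hG
      rw [← card_pos]
      exact_mod_cast pos_of_mul_pos_right this four_pos.le
    have lower := h.one_third_le_of_mem_nearDirections hU (by linarith) hz
    have upper : (m : ℝ) * (δ / 2 + ε) ≤ 2 * (17 * (1 / 128)) := by
      rw [hδ]
      gcongr
      linarith
    linarith
  · obtain ⟨j, rfl⟩ := Nat.exists_eq_add_of_le' hk
    have hm' : m * (j + 5 + 1) ≤ 2 ^ (j + 1) := by
      have : (m : ℝ) * ((j + 5 : ℕ) + 1) ≤ 2 ^ ((j + 1 : ℕ) : ℝ) :=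
        hm.trans <| Real.rpow_le_rpow_of_exponent_le one_le_two <| by
          push_cast
          linarith [j.cast_nonneg (α := ℝ)]
      rw [Real.rpow_natCast] at this
      exact_mod_cast this
    have hk' := h.two_pow_lt hε hδ.ge hG
    rw [mul_comm (j + 5 + 1), pow_add] at hk'
    rw [pow_succ] at hm'
    have := Nat.one_le_two_pow (n := j)
    omega

end LearnableWith

end Perturbation

lemma sq_mul_pow_four_le_of_lt {s c ε : ℝ} {n : ℕ} (hs : 0 ≤ s) (hε : 0 < ε)
    (h : s < c * 2 ^ (n / 2 : ℝ) / ε ^ 2) : s ^ 2 * ε ^ 4 ≤ c ^ 2 * 2 ^ n := by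
  rw [lt_div_iff₀ (by positivity)] at h
  calc s ^ 2 * ε ^ 4 = (s * ε ^ 2) ^ 2 := by ring
    _ ≤ (c * 2 ^ (n / 2 : ℝ)) ^ 2 := by gcongr
    _ = c ^ 2 * 2 ^ n := by
        rw [mul_pow, ← Real.rpow_mul_natCast two_pos.le]
        simp

theorem theoremB1 :
    ∃ ρ c ε₀ : ℝ, 0 < ρ ∧ 0 < c ∧ 0 < ε₀ ∧
      ∀ (n : ℕ) (_hn : 1 ≤ n) (ε : ℝ) (_hε : 0 < ε) (_hε₀ : ε ≤ ε₀)
        (C : Set (Distr n)) (_hU : uniformDistr n ∈ C)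
        (m : ℕ) (_hlearn : LearnableWith C ε m)
        (_hm : (m : ℝ) * (n : ℝ) ≤ (2 : ℝ) ^ (ρ * (n : ℝ)))
        (s : ℕ) (_htest : TestableWith C ε s),
          c * (2 : ℝ) ^ ((n : ℝ) / 2) / ε ^ 2 ≤ (s : ℝ) := by
  refine ⟨1 / 6, 1 / 2 ^ 14, 1 / 128, by norm_num, by norm_num, by norm_num, ?_⟩
  intro n hn ε hε hε₀ C hU m hlearn hm s htest
  obtain ⟨k, rfl⟩ := Nat.exists_eq_add_of_le' hn
  by_contra! hs
  let δ : I := ⟨32 * ε, by positivity, by linarith⟩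
  have sample_bound : (s : ℝ) ^ 2 * δ ^ 4 ≤ 2 ^ k / 36 := by
    have : (0 : ℝ) < 2 ^ k := by positivity
    calc (s : ℝ) ^ 2 * δ ^ 4 = 32 ^ 4 * (s ^ 2 * ε ^ 4) := by simp only [δ]; ring
      _ ≤ 32 ^ 4 * ((1 / 2 ^ 14) ^ 2 * 2 ^ (k + 1)) :=
          mul_le_mul_of_nonneg_left (sq_mul_pow_four_le_of_lt s.cast_nonneg hε hs) (by norm_num)
      _ ≤ 2 ^ k / 36 := by rw [pow_succ (2 : ℝ) k]; linarith
  have many_near := htest.two_pow_le_four_mul_card_nearDirections hU sample_bound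
  have many_samples := hlearn.two_rpow_lt_mul hU hε hε₀ rfl many_near
  push_cast at hm
  exact hm.not_gt many_samples
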